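/- Let $R$ be a commutative noetherian ring; "module" means $R$-module. For a module $M$ let $E(M)$ be its injective hull, put $\mho^0M=M$ and $\mho^{i+1}M=E(\mho^iM)/\mho^iM$, so that the minimal injective coresolution of $M$ has the terms $E(\mho^iM)$, $i\ge 0$. Let $$\mathcal Y:\quad Y_0\subseteq Y_1\subseteq\cdots\subseteq Y_i\subseteq\cdots$$ be an increasing sequence of subsets of $\operatorname{Spec}R$, each of them generalization closed (if $\mathfrak q\in Y_i$ and $\mathfrak p\subseteq\mathfrak q$ is prime, then $\mathfrak p\in Y_i$), such that $\bigcup_{i\ge 0}Y_i=\operatorname{Spec}R$ and $\operatorname{Ass}(\mho^iR)\subseteq Y_i$ for every $i\ge 0$. For generalization closed $Y\subseteq\operatorname{Spec}R$ let $\mathcal I(Y)$ be the class of all direct summands of direct sums of copies of $\bigoplus_{\mathfrak p\in Y}E(R/\mathfrak p)$. An $\mathcal I(Y)$-cover of a module $M$ is a homomorphism $f\colon E\to M$ with $E\in\mathcal I(Y)$ such that every homomorphism $E'\to M$ with $E'\in\mathcal I(Y)$ factors through $f$, and every endomorphism $g$ of $E$ with $fg=f$ is an automorphism; such covers exist and are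 unique up to isomorphism. For $\mathfrak p\in Y_0$ put $C_{\mathfrak p}=E(R/\mathfrak p)$. For $\mathfrak p\in Y_{i+1}\setminus Y_i$ with $i\ge 0$ put $K_{i+1}=E(R/\mathfrak p)$, let $K_j$ be the kernel of the $\mathcal I(Y_j)$-cover of $K_{j+1}$ for $j=i,i-1,\dots,0$, and put $C_{\mathfrak p}=K_0$. Let $$C=C(\mathcal Y)=\prod_{\mathfrak p\in\operatorname{Spec}R}C_{\mathfrak p}.$$ Let ${}^\perp C$ be the class of all modules $M$ with $\operatorname{Ext}^i_R(M,C)=0$ for all $i\ge 1$, and let $\mathcal C(\mathcal Y)$ be the class of all modules $X$ such that, for every $i\ge 0$, the $i$-th term $E(\mho^iX)$ of the minimal injective coresolution of $X$ is isomorphic to $\bigoplus_{\mathfrak p\in Y_i}E(R/\mathfrak p)^{(I_{\mathfrak p,i})}$ for some sets $I_{\mathfrak p,i}$. Then ${}^\perp C\subseteq\mathcal C(\mathcal Y)$. Moreover, if $Y_n=\operatorname{Spec}R$ for some $n\ge 1$, then ${}^\perp C=\mathcal C(\mathcal Y)$. -/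

import Mathlib

universe u

namespace Cotilting

open DirectSum

section Hulls

variable {R : Type u} [CommRing R]

theorem exists_essential_retract {Q : Type u} [AddCommGroup Q] [Module R Q]
    [Module.Injective R Q] (N : Submodule R Q) :
    ∃ D : Submodule R Q, N ≤ D ∧
      (∀ x ∈ D, x ≠ 0 → ∃ r : R, r • x ∈ N ∧ r • x ≠ 0) ∧
      ∃ ρ : Q →ₗ[R] D, ∀ d : D, ρ d = d := by
  obtain ⟨D, hND, hD⟩ := zorn_le_nonempty₀
    {D : Submodule R Q | N ≤ D ∧ ∀ x ∈ D, x ≠ 0 → ∃ r : R, r • x ∈ N ∧ r • x ≠ 0}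
    (by
      intro c hc hchain y hy
      refine ⟨sSup c, ⟨(hc hy).1.trans (le_sSup hy), ?_⟩, fun z hz => le_sSup hz⟩
      intro x hx hx0
      obtain ⟨z, hz, hxz⟩ :=
        (Submodule.mem_sSup_of_directed ⟨y, hy⟩ hchain.directedOn).1 hx
      exact (hc hz).2 x hxz hx0)
    N ⟨le_rfl, fun x hx hx0 => ⟨1, by simpa using hx, by simpa using hx0⟩⟩
  obtain ⟨L, -, hL⟩ := zorn_le_nonempty₀ {L : Submodule R Q | D ⊓ L = ⊥}
    (by
      intro c hc hchain y hy
      refine ⟨sSup c, ?_, fun z hz => le_sSup hz⟩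
      refine (Submodule.eq_bot_iff _).2 fun x hx => ?_
      obtain ⟨z, hz, hxz⟩ :=
        (Submodule.mem_sSup_of_directed ⟨y, hy⟩ hchain.directedOn).1 hx.2
      have : x ∈ D ⊓ z := ⟨hx.1, hxz⟩
      rw [show D ⊓ z = ⊥ from hc hz] at this
      simpa using this)
    ⊥ (by simp)
  have hDL : D ⊓ L = ⊥ := hL.prop
  obtain ⟨h, hh⟩ := Module.Injective.extension_property R Q D (Q ⧸ L)
    (L.mkQ ∘ₗ D.subtype)
    (by
      rw [← LinearMap.ker_eq_bot, LinearMap.ker_eq_bot']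
      intro d hd
      have h1 : (d : Q) ∈ L := by simpa using hd
      have h2 : (d : Q) ∈ D ⊓ L := ⟨d.2, h1⟩
      rw [hDL] at h2
      exact Subtype.ext (by simpa using h2))
    D.subtype
  have hd : ∀ d : D, h (L.mkQ d) = d := fun d => by simpa using LinearMap.congr_fun hh d
  have key : ∀ q : Q, q ∉ L → ∃ r : R, r • h (L.mkQ q) ∈ D ∧ r • h (L.mkQ q) ≠ 0 := by
    intro q hq
    have hne : D ⊓ (L ⊔ Submodule.span R {q}) ≠ ⊥ := by
      intro hbot
      exact hq (hL.le_of_ge hbot le_sup_left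
        (Submodule.mem_sup_right (Submodule.mem_span_singleton_self q)))
    obtain ⟨d, hdm, hd0⟩ := Submodule.exists_mem_ne_zero_of_ne_bot hne
    obtain ⟨l, hl, y, hy, hsum⟩ := Submodule.mem_sup.1 hdm.2
    obtain ⟨r, rfl⟩ := Submodule.mem_span_singleton.1 hy
    have : r • h (L.mkQ q) = d := by
      have h1 : L.mkQ l = 0 := by simpa using hl
      have h2 := hd ⟨d, hdm.1⟩
      simp only [← hsum, map_add, map_smul, h1, zero_add] at h2
      rw [h2, hsum]
    exact ⟨r, this ▸ hdm.1, this ▸ hd0⟩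
  have hDr : D ≤ LinearMap.range h := fun d hdD => ⟨L.mkQ d, hd ⟨d, hdD⟩⟩
  have hrD : LinearMap.range h ≤ D := by
    refine hD.le_of_ge ⟨hND.trans hDr, ?_⟩ hDr
    rintro _ ⟨q', rfl⟩ hq0
    obtain ⟨q, rfl⟩ := L.mkQ_surjective q'
    have hq : q ∉ L := fun hq => hq0 (by
      have : L.mkQ q = 0 := by simpa using hq
      rw [this, map_zero])
    obtain ⟨r, hr, hr0⟩ := key q hq
    obtain ⟨s, hs, hs0⟩ := hD.prop.2 _ hr hr0
    exact ⟨s * r, by rwa [mul_smul], by rwa [mul_smul]⟩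
  exact ⟨D, hND, hD.prop.2, LinearMap.codRestrict D (h ∘ₗ L.mkQ) fun q => hrD ⟨_, rfl⟩,
    fun d => Subtype.ext (hd d)⟩

theorem injective_of_retract {E Q : Type u} [AddCommGroup E] [Module R E] [AddCommGroup Q]
    [Module R Q] [Module.Injective R Q] (i : E →ₗ[R] Q) (r : Q →ₗ[R] E)
    (h : r ∘ₗ i = LinearMap.id) : Module.Injective R E where
  out X Y _ _ _ _ f hf g := by
    obtain ⟨k, hk⟩ := Module.Injective.out f hf (i ∘ₗ g)
    exact ⟨r ∘ₗ k, fun x => by simpa [hk] using LinearMap.congr_fun h (g x)⟩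

/-- A submodule is essential if it meets every non-zero submodule non-trivially. -/
def IsEssential {M : Type u} [AddCommGroup M] [Module R M] (N : Submodule R M) : Prop :=
  ∀ L : Submodule R M, N ⊓ L = ⊥ → L = ⊥

/-- `f : M → E` is an injective hull of `M`: an essential embedding into an injective module. -/
structure IsInjectiveHull {M E : Type u} [AddCommGroup M] [Module R M] [AddCommGroup E]
    [Module R E] (f : M →ₗ[R] E) : Prop where
  injective_module : Module.Injective R E
  injective : Function.Injective f
  essential : IsEssential (LinearMap.range f)

theorem isEssential_of_smul {M : Type u} [AddCommGroup M] [Module R M] {N : Submodule R M}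
    (h : ∀ x : M, x ≠ 0 → ∃ r : R, r • x ∈ N ∧ r • x ≠ 0) : IsEssential N := by
  intro L hL
  refine (Submodule.eq_bot_iff _).2 fun x hx => ?_
  by_contra hx0
  obtain ⟨r, hr, hr0⟩ := h x hx0
  have : r • x ∈ N ⊓ L := ⟨hr, L.smul_mem r hx⟩
  rw [hL] at this
  exact hr0 (by simpa using this)

theorem exists_injectiveHull (M : ModuleCat.{u} R) :
    ∃ (E : ModuleCat.{u} R) (f : M →ₗ[R] E), IsInjectiveHull f := by
  let Q : ModuleCat.{u} R := CategoryTheory.Injective.under M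
  let i : M →ₗ[R] Q := (CategoryTheory.Injective.ι M).hom
  have hi : Function.Injective i :=
    (ModuleCat.mono_iff_injective (CategoryTheory.Injective.ι M)).1 inferInstance
  have : CategoryTheory.Injective (ModuleCat.of R Q) :=
    inferInstanceAs (CategoryTheory.Injective (CategoryTheory.Injective.under M))
  have : Module.Injective R Q := Module.injective_module_of_injective_object R Q
  obtain ⟨D, hND, hess, ρ, hρ⟩ := exists_essential_retract (LinearMap.range i)
  refine ⟨ModuleCat.of R D, LinearMap.codRestrict D i fun m => hND ⟨m, rfl⟩,
    injective_of_retract D.subtype ρ (LinearMap.ext hρ), ?_, ?_⟩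
  · intro a b hab
    exact hi (congrArg Subtype.val hab)
  · refine isEssential_of_smul fun x hx => ?_
    obtain ⟨r, ⟨m, hm⟩, hr0⟩ := hess x x.2 (fun h => hx (Subtype.ext h))
    exact ⟨r, ⟨m, Subtype.ext hm⟩, fun h => hr0 (congrArg Subtype.val h)⟩

end Hulls

section Noetherian

variable {R : Type u} [CommRing R] [IsNoetherianRing R]

theorem injective_directSum {ι : Type u} (E : ι → Type u) [∀ i, AddCommGroup (E i)]
    [∀ i, Module R (E i)] [∀ i, Module.Injective R (E i)] :
    Module.Injective R (⨁ i, E i) := by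
  classical
  apply Module.Baer.injective
  intro I g
  obtain ⟨t, ht⟩ := (isNoetherian_def.1 (inferInstance : IsNoetherian R I)) ⊤
  let s : Finset ι := t.biUnion fun x => DFinsupp.support (g x)
  have hs : ∀ (x : I) (i : ι), i ∉ s → g x i = 0 := by
    intro x i hi
    have hx : x ∈ Submodule.span R (t : Set I) := ht ▸ Submodule.mem_top
    induction hx using Submodule.span_induction with
    | mem y hy =>
      by_contra h
      exact hi (Finset.mem_biUnion.2 ⟨y, hy, DFinsupp.mem_support_iff.2 h⟩)
    | zero => simp
    | add y z _ _ hy hz => simp [hy, hz]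
    | smul r y _ hy => simp [DirectSum.smul_apply, hy]
  have hpi : Module.Injective R (∀ i, E i) := inferInstance
  obtain ⟨k, hk⟩ := Module.Baer.of_injective hpi I
    ((LinearMap.pi fun i => DirectSum.component R ι E i) ∘ₗ g)
  refine ⟨LinearMap.toSpanSingleton R _ (DirectSum.mk E s fun i => k 1 i), fun x hx => ?_⟩
  ext i
  have h1 : x • k 1 i = g ⟨x, hx⟩ i := by
    have h2 : k x = x • k 1 := by rw [← map_smul, smul_eq_mul, mul_one]
    have h3 := congrFun (hk x hx) i
    rw [h2] at h3
    exact h3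
  by_cases hi : i ∈ s
  · rw [LinearMap.toSpanSingleton_apply, DirectSum.smul_apply, DirectSum.mk_apply_of_mem hi, h1]
  · rw [LinearMap.toSpanSingleton_apply, DirectSum.smul_apply, DirectSum.mk_apply_of_notMem hi,
      hs _ i hi, smul_zero]

theorem injective_sSup {Q : Type u} [AddCommGroup Q] [Module R Q] (c : Set (Submodule R Q))
    (hc : c.Nonempty) (hd : DirectedOn (· ≤ ·) c)
    (h : ∀ N ∈ c, Module.Injective R N) : Module.Injective R (sSup c : Submodule R Q) := by
  apply Module.Baer.injective
  intro I g
  let g0 : I →ₗ[R] Q := (sSup c).subtype ∘ₗ g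
  have hfg : (LinearMap.range g0).FG := by
    rw [LinearMap.range_eq_map]
    exact ((isNoetherian_def.1 (inferInstance : IsNoetherian R I)) ⊤).map g0
  have hle : LinearMap.range g0 ≤ sSup c := by
    rintro _ ⟨x, rfl⟩
    exact (g x).2
  obtain ⟨N, hN, hNle⟩ := (CompleteLattice.isCompactElement_iff_le_of_directed_sSup_le _ _).1
    ((Submodule.fg_iff_compact _).1 hfg) c hc hd hle
  obtain ⟨k, hk⟩ := Module.Baer.of_injective (h N hN) I
    (LinearMap.codRestrict N g0 fun x => hNle ⟨x, rfl⟩)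
  refine ⟨Submodule.inclusion (le_sSup hN) ∘ₗ k, fun x hx => Subtype.ext ?_⟩
  simp [hk x hx, g0]

theorem bijective_of_essential_ker {E : Type u} [AddCommGroup E] [Module R E]
    (g : E →ₗ[R] E)
    (h : ∀ x : E, x ≠ 0 → ∃ r : R, r • x ∈ LinearMap.ker (LinearMap.id - g) ∧ r • x ≠ 0) :
    Function.Bijective g := by
  set a : E →ₗ[R] E := LinearMap.id - g with ha
  have hnil : ∀ x : E, ∃ n : ℕ, (a ^ n) x = 0 := by
    intro x
    let f : ℕ →o Ideal R := ⟨fun n => LinearMap.ker (LinearMap.toSpanSingleton R E ((a ^ n) x)), by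
      refine monotone_nat_of_le_succ fun n r hr => ?_
      simp only [LinearMap.mem_ker, LinearMap.toSpanSingleton_apply] at hr ⊢
      rw [pow_succ', Module.End.mul_apply, ← map_smul, hr, map_zero]⟩
    obtain ⟨n, hn⟩ := monotone_stabilizes_iff_noetherian.2 (inferInstance : IsNoetherian R R) f
    refine ⟨n, ?_⟩
    by_contra hne
    obtain ⟨r, hr, hr0⟩ := h _ hne
    apply hr0
    have h1 : r ∈ f (n + 1) := by
      show r ∈ LinearMap.ker (LinearMap.toSpanSingleton R E ((a ^ (n + 1)) x))
      simp only [LinearMap.mem_ker, LinearMap.toSpanSingleton_apply]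
      rw [pow_succ', Module.End.mul_apply, ← map_smul]
      exact hr
    rw [← hn (n + 1) (Nat.le_succ n)] at h1
    exact h1
  have hg : g = 1 - a := by rw [ha]; ext; simp
  constructor
  · rw [← LinearMap.ker_eq_bot, LinearMap.ker_eq_bot']
    intro x hx
    obtain ⟨n, hn⟩ := hnil x
    have hax : a x = x := by simp [ha, hx]
    have : ∀ n : ℕ, (a ^ n) x = x := by
      intro n
      induction n with
      | zero => rfl
      | succ n ih => rw [pow_succ, Module.End.mul_apply, hax, ih]
    rw [← this n, hn]
  · intro x
    obtain ⟨n, hn⟩ := hnil x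
    refine ⟨(∑ i ∈ Finset.range n, a ^ i) x, ?_⟩
    rw [hg, ← Module.End.mul_apply, mul_neg_geom_sum]
    simp [hn]

end Noetherian

section Covers

variable {R : Type u} [CommRing R]

/-- `Add G`: the class of all direct summands of direct sums of copies of `G`. -/
def Add (G : ModuleCat.{u} R) : Set (ModuleCat.{u} R) :=
  {M | ∃ (I : Type u) (i : M →ₗ[R] (⨁ _ : I, G)) (r : (⨁ _ : I, G) →ₗ[R] M),
    r ∘ₗ i = LinearMap.id}

/-- `f : E → M` is a `𝒞`-precover of `M`. -/
structure IsPrecover (𝒞 : Set (ModuleCat.{u} R)) {E M : ModuleCat.{u} R} (f : E →ₗ[R] M) :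
    Prop where
  mem : E ∈ 𝒞
  lift : ∀ C' ∈ 𝒞, ∀ f' : C' →ₗ[R] M, ∃ g : C' →ₗ[R] E, f ∘ₗ g = f'

/-- `f : E → M` is a `𝒞`-cover of `M`: a precover such that every endomorphism `g` of `E` with
`f g = f` is an automorphism. -/
structure IsCover (𝒞 : Set (ModuleCat.{u} R)) {E M : ModuleCat.{u} R} (f : E →ₗ[R] M) : Prop
    extends IsPrecover 𝒞 f where
  bijective : ∀ g : E →ₗ[R] E, f ∘ₗ g = f → Function.Bijective g

theorem exists_precover_add (G M : ModuleCat.{u} R) :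
    ∃ (E : ModuleCat.{u} R) (f : E →ₗ[R] M), IsPrecover (Add G) f := by
  classical
  refine ⟨ModuleCat.of R (⨁ _ : (G →ₗ[R] M), G),
    DirectSum.toModule R (G →ₗ[R] M) M fun h => h,
    ⟨_, LinearMap.id, LinearMap.id, rfl⟩, ?_⟩
  rintro C' ⟨I, i, r, hri⟩ f'
  refine ⟨(DirectSum.toModule R I (⨁ _ : (G →ₗ[R] M), G) fun j =>
    DirectSum.lof R (G →ₗ[R] M) (fun _ => G) (f' ∘ₗ r ∘ₗ DirectSum.lof R I (fun _ => G) j)) ∘ₗ i,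
    ?_⟩
  have h1 : (DirectSum.toModule R (G →ₗ[R] M) M fun h => h) ∘ₗ
      (DirectSum.toModule R I (⨁ _ : (G →ₗ[R] M), G) fun j =>
        DirectSum.lof R (G →ₗ[R] M) (fun _ => G)
          (f' ∘ₗ r ∘ₗ DirectSum.lof R I (fun _ => G) j)) = f' ∘ₗ r := by
    refine DirectSum.linearMap_ext R fun j => LinearMap.ext fun x => ?_
    simp
  calc _ = (f' ∘ₗ r) ∘ₗ i := by rw [← h1]; rfl
    _ = f' := by rw [LinearMap.comp_assoc, hri, LinearMap.comp_id]

theorem exists_cover_add [IsNoetherianRing R] (G : ModuleCat.{u} R) [Module.Injective R G]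
    (M : ModuleCat.{u} R) :
    ∃ (E : ModuleCat.{u} R) (f : E →ₗ[R] M), IsCover (Add G) f := by
  have hinj : ∀ E ∈ Add G, Module.Injective R E := by
    rintro E ⟨I, i, r, h⟩
    have : Module.Injective R (⨁ _ : I, G) := injective_directSum fun _ => G
    exact injective_of_retract i r h
  obtain ⟨E, f, hf⟩ := exists_precover_add G M
  have := hinj E hf.mem
  obtain ⟨N, -, hN⟩ := zorn_le_nonempty₀
    {N : Submodule R E | Module.Injective R N ∧ N ≤ LinearMap.ker f}
    (by
      intro c hc hchain y hy
      exact ⟨sSup c, ⟨injective_sSup c ⟨y, hy⟩ hchain.directedOn fun N hN => (hc hN).1,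
        sSup_le fun N hN => (hc hN).2⟩, fun z hz => le_sSup hz⟩)
    ⊥ ⟨⟨fun _ _ _ _ _ _ _ _ _ => ⟨0, fun _ => Subsingleton.elim _ _⟩⟩, bot_le⟩
  have := hN.prop.1
  obtain ⟨ρ, hρ⟩ := Module.Injective.extension_property R N N E N.subtype N.injective_subtype
    LinearMap.id
  have hρ' : ∀ n : N, ρ n = n := fun n => LinearMap.congr_fun hρ n
  let K : Submodule R E := LinearMap.ker ρ
  let π : E →ₗ[R] K := LinearMap.codRestrict K (LinearMap.id - N.subtype ∘ₗ ρ) fun x => by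
    simp [K, hρ']
  have hπc : ∀ x, (π x : E) = x - ρ x := fun _ => rfl
  have hπ : ∀ k : K, π k = k := fun k => Subtype.ext (by
    have : ρ k = 0 := k.2
    simp [hπc, this])
  have hfπ : ∀ x, f (π x) = f x := fun x => by
    have : f (ρ x) = 0 := hN.prop.2 (ρ x).2
    simp [hπc, this]
  have hKmem : ModuleCat.of R K ∈ Add G := by
    obtain ⟨I, i, r, h⟩ := hf.mem
    refine ⟨I, i ∘ₗ K.subtype, π ∘ₗ r, LinearMap.ext fun k => ?_⟩
    have := LinearMap.congr_fun h (k : E)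
    simp only [LinearMap.comp_apply, LinearMap.id_apply] at this ⊢
    erw [this]
    exact hπ k
  have : Module.Injective R K := hinj _ hKmem
  refine ⟨ModuleCat.of R K, f ∘ₗ K.subtype, ⟨hKmem, ?_⟩, ?_⟩
  · intro C' hC' f'
    obtain ⟨g, hg⟩ := hf.lift C' hC' f'
    exact ⟨π ∘ₗ g, LinearMap.ext fun x => (hfπ _).trans (LinearMap.congr_fun hg x)⟩
  · intro g hg
    change K →ₗ[R] K at g
    have hg' : ∀ k : K, f (g k) = f k := fun k => LinearMap.congr_fun hg k
    apply bijective_of_essential_ker g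
    set a : K →ₗ[R] K := LinearMap.id - g with ha
    obtain ⟨D, hD, hess, σ, hσ⟩ := exists_essential_retract (LinearMap.ker a)
    let D' : Submodule R K := LinearMap.ker σ
    -- `N ⊕ a(D')` is an injective submodule of the kernel of `f`
    have haD : ∀ d ∈ D', a d = 0 → d = 0 := fun d hd h0 => by
      have h1 : d ∈ D := hD h0
      have h2 := hσ ⟨d, h1⟩
      have h3 : σ d = 0 := hd
      rw [h3] at h2
      exact (congrArg Subtype.val h2).symm
    let τ : K →ₗ[R] D' := LinearMap.codRestrict D' (LinearMap.id - D.subtype ∘ₗ σ) fun x => by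
      simp [D', hσ]
    have hτc : ∀ x, (τ x : K) = x - σ x := fun _ => rfl
    have hτ : ∀ d : D', τ d = d := fun d => Subtype.ext (by
      have : σ d = 0 := d.2
      simp [hτc, this])
    have : Module.Injective R D' :=
      injective_of_retract D'.subtype τ (LinearMap.ext hτ)
    let j : (N × D') →ₗ[R] E :=
      LinearMap.coprod N.subtype (K.subtype ∘ₗ a ∘ₗ D'.subtype)
    have hj : Function.Injective j := by
      rw [← LinearMap.ker_eq_bot, LinearMap.ker_eq_bot']
      rintro ⟨n, d⟩ h
      have h0 : (n : E) + (a d : E) = 0 := by simpa [j] using h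
      have h1 : ρ (n : E) = 0 := by
        have h2 : ρ ((a (d : K) : K) : E) = 0 := (a (d : K)).2
        have := congrArg ρ h0
        simpa only [map_add, h2, add_zero, map_zero] using this
      rw [hρ'] at h1
      subst h1
      have h2 : a (d : K) = 0 := Subtype.ext (by simpa using h0)
      have h3 : d = 0 := Subtype.ext (haD _ d.2 h2)
      rw [h3]; rfl
    have : Module.Injective R (N × D') := ⟨fun X Y _ _ _ _ f hf g => by
      obtain ⟨k1, hk1⟩ := Module.Injective.out f hf (LinearMap.fst R N D' ∘ₗ g)
      obtain ⟨k2, hk2⟩ := Module.Injective.out f hf (LinearMap.snd R N D' ∘ₗ g)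
      exact ⟨k1.prod k2, fun x => Prod.ext (hk1 x) (hk2 x)⟩⟩
    let e := LinearEquiv.ofInjective j hj
    have hrange : LinearMap.range j ≤ N := by
      refine hN.le_of_ge ⟨injective_of_retract e.symm.toLinearMap e.toLinearMap ?_, ?_⟩ ?_
      · ext x; simp
      · rintro _ ⟨⟨n, d⟩, rfl⟩
        have h1 : f n = 0 := hN.prop.2 n.2
        simp [j, h1, ha, hg']
      · intro n hn
        exact ⟨(⟨n, hn⟩, 0), by simp [j]⟩
    have hD'0 : ∀ d : D', d = 0 := fun d => by
      have h1 : ((a (d : K) : K) : E) ∈ N := hrange ⟨(0, d), by simp [j]⟩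
      have h2 : ρ ((a (d : K) : K) : E) = 0 := (a (d : K)).2
      have h3 := hρ' ⟨_, h1⟩
      rw [h2] at h3
      exact Subtype.ext (haD _ d.2 (Subtype.ext (congrArg Subtype.val h3).symm))
    intro x hx
    have hxD : x ∈ D := by
      have : ((τ x : D') : K) = 0 := congrArg Subtype.val (hD'0 (τ x))
      have h4 : x - (σ x : K) = 0 := by rw [← hτc, this]
      rw [sub_eq_zero.1 h4]
      exact (σ x).2
    exact hess x hxD hx

end Covers

section Construction

variable {R : Type u} [CommRing R]

/-- The injective hull `E(M)` of a module `M`. -/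
noncomputable def injHull (M : ModuleCat.{u} R) : ModuleCat.{u} R :=
  (exists_injectiveHull M).choose

/-- The embedding `M → E(M)`. -/
noncomputable def toInjHull (M : ModuleCat.{u} R) :
    M →ₗ[R] injHull M :=
  (exists_injectiveHull M).choose_spec.choose

theorem isInjectiveHull_toInjHull (M : ModuleCat.{u} R) :
    IsInjectiveHull (toInjHull M) :=
  (exists_injectiveHull M).choose_spec.choose_spec

instance (M : ModuleCat.{u} R) : Module.Injective R (injHull M) :=
  (isInjectiveHull_toInjHull M).injective_module

/-- The `i`-th cosyzygy `℧ⁱ M` in the minimal injective coresolution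
`0 → M → E(M) → E(℧¹ M) → E(℧² M) → ⋯` of `M`, whose `i`-th term is `E(℧ⁱ M)`. -/
noncomputable def cosyzygy (M : ModuleCat.{u} R) : ℕ → ModuleCat.{u} R
  | 0 => M
  | i + 1 => ModuleCat.of R
      (injHull (cosyzygy M i) ⧸ LinearMap.range (toInjHull (cosyzygy M i)))

/-- The indecomposable injective module `E(R/𝔭)`. -/
noncomputable abbrev primeHull (p : PrimeSpectrum R) : ModuleCat.{u} R :=
  injHull (ModuleCat.of R (R ⧸ p.asIdeal))

/-- A set of primes is generalization closed if it contains, with `𝔮`, all primes `𝔭 ⊆ 𝔮`. -/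
def GeneralizationClosed (Y : Set (PrimeSpectrum R)) : Prop :=
  ∀ q ∈ Y, ∀ p : PrimeSpectrum R, p.asIdeal ≤ q.asIdeal → p ∈ Y

/-- The module `⨁_{𝔭 ∈ Y} E(R/𝔭)`. -/
noncomputable def sumPrimeHulls (Y : Set (PrimeSpectrum R)) : ModuleCat.{u} R :=
  ModuleCat.of R (⨁ p : Y, primeHull p.1)

/-- The class `𝓘(Y) = Add (⨁_{𝔭 ∈ Y} E(R/𝔭))`. -/
def injClass (Y : Set (PrimeSpectrum R)) : Set (ModuleCat.{u} R) :=
  Add (sumPrimeHulls Y)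

theorem exists_cover_injClass [IsNoetherianRing R] (Y : Set (PrimeSpectrum R))
    (M : ModuleCat.{u} R) :
    ∃ (E : ModuleCat.{u} R) (f : E →ₗ[R] M), IsCover (injClass Y) f :=
  have : Module.Injective R (sumPrimeHulls Y) :=
    injective_directSum fun p : Y => primeHull p.1
  exists_cover_add (sumPrimeHulls Y) M

variable (R) in
/-- An increasing sequence `Y 0 ⊆ Y 1 ⊆ ⋯` of generalization closed subsets of `Spec R` with union
`Spec R` such that `Ass (℧ⁱ R) ⊆ Y i` for all `i`. -/
structure SpecSequence where
  /-- the members of the sequence -/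
  Y : ℕ → Set (PrimeSpectrum R)
  monotone : Monotone Y
  generalizationClosed : ∀ i, GeneralizationClosed (Y i)
  iUnion_eq : ⋃ i, Y i = Set.univ
  ass_subset : ∀ i, ∀ p : PrimeSpectrum R,
    p.asIdeal ∈ associatedPrimes R (cosyzygy (ModuleCat.of R R) i) → p ∈ Y i

namespace SpecSequence

variable (𝒴 : SpecSequence R)

theorem exists_mem (p : PrimeSpectrum R) : ∃ i, p ∈ 𝒴.Y i :=
  Set.mem_iUnion.1 (𝒴.iUnion_eq ▸ Set.mem_univ p)

open Classical in
/-- The least `m` with `𝔭 ∈ Y m`: it is `0` for `𝔭 ∈ Y 0`, and `i + 1` for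
`𝔭 ∈ Y (i + 1) \ Y i`. -/
noncomputable def level (p : PrimeSpectrum R) : ℕ := Nat.find (𝒴.exists_mem p)

/-- The class `𝓒(𝒴)` of all modules `X` such that, for each `i`, the `i`-th term of the minimal
injective coresolution of `X` is of the form `⨁_{𝔭 ∈ Y i} E(R/𝔭)^(I_𝔭)`. -/
def cotiltingClass : Set (ModuleCat.{u} R) :=
  {X | ∀ i, ∃ I : 𝒴.Y i → Type u,
    Nonempty (injHull (cosyzygy X i) ≃ₗ[R] ⨁ p : 𝒴.Y i, ⨁ _ : I p, primeHull p.1)}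

end SpecSequence

/-- The class `^⊥ C` of all modules `M` with `Ext^i_R(M, C) = 0` for all `i ≥ 1`. -/
def leftPerp (C : ModuleCat.{u} R) : Set (ModuleCat.{u} R) :=
  {M | ∀ i : ℕ, 1 ≤ i → Subsingleton (CategoryTheory.Abelian.Ext M C i)}

variable [IsNoetherianRing R]

/-- The source of the `𝓘(Y)`-cover of `M`. -/
noncomputable def coverObj (Y : Set (PrimeSpectrum R)) (M : ModuleCat.{u} R) : ModuleCat.{u} R :=
  (exists_cover_injClass Y M).choose

/-- The `𝓘(Y)`-cover of `M`. -/
noncomputable def coverMap (Y : Set (PrimeSpectrum R)) (M : ModuleCat.{u} R) :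
    coverObj Y M →ₗ[R] M :=
  (exists_cover_injClass Y M).choose_spec.choose

theorem isCover_coverMap (Y : Set (PrimeSpectrum R)) (M : ModuleCat.{u} R) :
    IsCover (injClass Y) (coverMap Y M) :=
  (exists_cover_injClass Y M).choose_spec.choose_spec

/-- Given sets `Y 0, Y 1, …` of primes and a module `E`, put `K_m = E` and, going down,
`K_j = Ker (Φ_j : E_j → K_{j+1})`, where `Φ_j` is the `𝓘(Y j)`-cover of `K_{j+1}`, for
`j = m - 1, …, 0`. Then `iteratedKernel Y m E = K_0`. Splicing the maps `Φ_j` with the inclusions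
`K_{j+1} ⊆ E_{j+1}` gives the complex `0 → K_0 → E_0 → E_1 → ⋯ → E_{m-1} → E → 0`. -/
noncomputable def iteratedKernel (Y : ℕ → Set (PrimeSpectrum R)) :
    ℕ → ModuleCat.{u} R → ModuleCat.{u} R
  | 0, E => E
  | j + 1, E => iteratedKernel Y j (ModuleCat.of R (LinearMap.ker (coverMap (Y j) E)))

namespace SpecSequence

variable (𝒴 : SpecSequence R)

/-- The module `C_𝔭`: it is `E(R/𝔭)` if `𝔭 ∈ Y 0`, and for `𝔭 ∈ Y (i + 1) \ Y i` it is the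
kernel of `E_0 → E_1` in the complex `0 → C_𝔭 → E_0 → ⋯ → E_i → E(R/𝔭) → 0` built from
`E(R/𝔭)` by taking the `𝓘(Y i)`-cover, then the `𝓘(Y (i - 1))`-cover of its kernel, and so on down
to the `𝓘(Y 0)`-cover. -/
noncomputable def primeModule (p : PrimeSpectrum R) : ModuleCat.{u} R :=
  iteratedKernel 𝒴.Y (𝒴.level p) (primeHull p)

/-- The module `C(𝒴) = ∏_{𝔭 ∈ Spec R} C_𝔭`. -/
noncomputable def cotiltingModule : ModuleCat.{u} R :=
  ModuleCat.of R (∀ p : PrimeSpectrum R, 𝒴.primeModule p)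

end SpecSequence

end Construction

end Cotilting

/-! The argument is dimension shifting along 0 → K_j → E_j → K_{j+1} → 0, where E_j → K_{j+1} is the
𝓘(Y j)-cover.

Let the s-th shifted class consist of the X with E(℧ᵗX) in 𝓘(Y (s + t)) for all t; for s = 0 this is
𝓒(𝒴). Maps from its members into K_{s+1} lift to E_s: this is clear for an injective target, and
`LiftsToCover.ker` passes it from a module to the kernel of its cover while s drops by one. The
condition on Ass(℧ⁱR) puts R in every shifted class, so the covers are onto and the sequences exact.
As E_j is injective, lifting amounts to Ext¹(X, K_j) = 0, and higher Ext groups into K_j reduce to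
lower ones into K_{j+1}. Hence Extᵏ(X, C_𝔭) = 0 for k > s (`subsingleton_ext_primeModule`), and s =
0 gives 𝓒(𝒴) ⊆ ^⊥C.

Conversely, if Extᵏ(M, C_𝔭) = 0 for all k > i, then 𝔭 ∈ Ass M forces 𝔭 ∈ Y i
(`mem_of_subsingleton_ext`): otherwise R/𝔭 → E(R/𝔭) would lift to a cover without 𝔭 among its
associated primes. For M in ^⊥C this vanishing passes from ℧ⁱM to ℧ⁱ⁺¹M by induction, and by Matlis'
decomposition Ass(℧ⁱM) ⊆ Y i says that E(℧ⁱM) has the required form. -/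

namespace Cotilting

open CategoryTheory Abelian

/-! ### Vanishing of Ext: dimension shifting, retracts, products. -/

section Ext

variable {R : Type u} [CommRing R] {A B C : ModuleCat.{u} R} {f : A →ₗ[R] B} {g : B →ₗ[R] C}

theorem exists_shortExact (hf : Function.Injective f) (hfg : Function.Exact f g)
    (hg : Function.Surjective g) :
    ∃ w, (ShortComplex.mk (ModuleCat.ofHom f) (ModuleCat.ofHom g) w).ShortExact :=
  ⟨by ext x; exact hfg.apply_apply_eq_zero x, ModuleCat.shortComplex_shortExact _ hfg hf hg⟩

theorem subsingleton_ext_of_injective (M E : ModuleCat.{u} R) [h : Module.Injective R E] {n : ℕ}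
    (hn : 1 ≤ n) : Subsingleton (Ext M E n) := by
  obtain ⟨n, rfl⟩ := Nat.exists_eq_add_of_le' hn
  have : Injective E := Module.injective_object_of_injective_module R E
  exact Ext.subsingleton_of_injective M E n

theorem subsingleton_ext_succ_iff (hf : Function.Injective f) (hfg : Function.Exact f g)
    (hg : Function.Surjective g) [Module.Injective R B] (M : ModuleCat.{u} R) {n : ℕ}
    (hn : 1 ≤ n) : Subsingleton (Ext M A (n + 1)) ↔ Subsingleton (Ext M C n) := by
  obtain ⟨w, hS⟩ := exists_shortExact hf hfg hg
  have h1 := subsingleton_ext_of_injective M B hn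
  have h2 := subsingleton_ext_of_injective M B (n := n + 1) (by lia)
  constructor <;> intro h <;> refine subsingleton_of_forall_eq 0 fun x => ?_
  · obtain ⟨y, hy⟩ := Ext.covariant_sequence_exact₃ M hS x rfl (h.elim _ _)
    rw [← hy, h1.elim y 0, Ext.zero_comp]
  · obtain ⟨y, hy⟩ := Ext.covariant_sequence_exact₁ M hS x (h2.elim _ _) rfl
    rw [← hy, h.elim y 0, Ext.zero_comp]

/-- Since `B` is injective, Hom(M, C) → Ext¹(M, A) is onto, and its kernel consists of the maps that
lift to `B`. -/
theorem subsingleton_ext_one_iff (hf : Function.Injective f) (hfg : Function.Exact f g)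
    (hg : Function.Surjective g) [Module.Injective R B] (M : ModuleCat.{u} R) :
    Subsingleton (Ext M A 1) ↔ ∀ h : M →ₗ[R] C, ∃ k : M →ₗ[R] B, g ∘ₗ k = h := by
  obtain ⟨w, hS⟩ := exists_shortExact hf hfg hg
  have h2 := subsingleton_ext_of_injective M B (n := 1) le_rfl
  constructor
  · intro h φ
    obtain ⟨y, hy⟩ := Ext.covariant_sequence_exact₃ M hS (Ext.mk₀ (ModuleCat.ofHom φ)) (zero_add 1)
      (h.elim _ _)
    obtain ⟨k, rfl⟩ := (Ext.mk₀_bijective M B).2 y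
    rw [Ext.mk₀_comp_mk₀] at hy
    exact ⟨k.hom, congrArg ModuleCat.Hom.hom ((Ext.mk₀_bijective M C).1 hy)⟩
  · intro h
    refine subsingleton_of_forall_eq 0 fun x => ?_
    obtain ⟨y, hy⟩ := Ext.covariant_sequence_exact₁ M hS x (h2.elim _ _) (zero_add 1)
    obtain ⟨φ, rfl⟩ := (Ext.mk₀_bijective M C).2 y
    obtain ⟨k, hk⟩ := h φ.hom
    have : φ = ModuleCat.ofHom k ≫ ModuleCat.ofHom g := by
      ext x; exact (LinearMap.congr_fun hk x).symm
    rw [← hy, this, ← Ext.mk₀_comp_mk₀, Ext.comp_assoc_of_second_deg_zero]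
    erw [hS.comp_extClass]
    rw [Ext.comp_zero]

/-- Used to pass from ℧ⁱM to ℧ⁱ⁺¹M in the first variable. -/
theorem subsingleton_ext_coker (hf : Function.Injective f) (hfg : Function.Exact f g)
    (hg : Function.Surjective g) (N : ModuleCat.{u} R) {n : ℕ}
    (h1 : Subsingleton (Ext A N n)) (h2 : Subsingleton (Ext B N (n + 1))) :
    Subsingleton (Ext C N (n + 1)) := by
  obtain ⟨w, hS⟩ := exists_shortExact hf hfg hg
  refine subsingleton_of_forall_eq 0 fun x => ?_
  obtain ⟨y, hy⟩ := Ext.contravariant_sequence_exact₃ hS N x (h2.elim _ _) (add_comm 1 n)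
  rw [← hy, h1.elim y 0, Ext.comp_zero]

theorem subsingleton_ext_of_retract {M N P : ModuleCat.{u} R} (i : N →ₗ[R] P) (r : P →ₗ[R] N)
    (h : r ∘ₗ i = LinearMap.id) {n : ℕ} (hP : Subsingleton (Ext M P n)) :
    Subsingleton (Ext M N n) := by
  refine subsingleton_of_forall_eq 0 fun x => ?_
  have hir : ModuleCat.ofHom i ≫ ModuleCat.ofHom r = 𝟙 N := by
    ext x; exact LinearMap.congr_fun h x
  calc x = x.comp (Ext.mk₀ (𝟙 N)) (add_zero n) := (Ext.comp_mk₀_id x).symm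
    _ = (x.comp (Ext.mk₀ (ModuleCat.ofHom i)) (add_zero n)).comp
        (Ext.mk₀ (ModuleCat.ofHom r)) (add_zero n) := by
      rw [← hir, ← Ext.mk₀_comp_mk₀, Ext.comp_assoc_of_third_deg_zero]
    _ = 0 := by rw [hP.elim (x.comp _ _) 0, Ext.zero_comp]

theorem exact_toInjHull_mkQ (M : ModuleCat.{u} R) :
    Function.Exact (toInjHull M) (LinearMap.range (toInjHull M)).mkQ :=
  LinearMap.exact_map_mkQ_range _

/-- The product of the sequences 0 → N_i → E(N_i) → ℧N_i → 0 is exact with injective middle term.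
Lifts are chosen coordinatewise in degree one, and higher degrees shift down to the family ℧N_i,
which is why the induction quantifies over all families. -/
theorem subsingleton_ext_pi (M : ModuleCat.{u} R) {n : ℕ} (hn : 1 ≤ n) {ι : Type u} :
    ∀ N : ι → ModuleCat.{u} R, (∀ i, Subsingleton (Ext M (N i) n)) →
      Subsingleton (Ext M (ModuleCat.of R (∀ i, N i)) n) := by
  have hinj (N : ι → ModuleCat.{u} R) :
      Function.Injective (LinearMap.piMap fun i => toInjHull (N i)) := fun x y hxy =>
    funext fun i => (isInjectiveHull_toInjHull (N i)).injective (congrFun hxy i)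
  have hsurj (N : ι → ModuleCat.{u} R) :
      Function.Surjective (LinearMap.piMap fun i => (LinearMap.range (toInjHull (N i))).mkQ) :=
    Function.Surjective.piMap fun i => Submodule.mkQ_surjective _
  have hex (N : ι → ModuleCat.{u} R) :
      Function.Exact (LinearMap.piMap fun i => toInjHull (N i))
        (LinearMap.piMap fun i => (LinearMap.range (toInjHull (N i))).mkQ) := by
    intro x
    constructor
    · intro hx
      choose y hy using fun i => (exact_toInjHull_mkQ (N i) (x i)).1 (congrFun hx i)
      exact ⟨y, funext hy⟩
    · rintro ⟨y, rfl⟩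
      exact funext fun i => (exact_toInjHull_mkQ (N i)).apply_apply_eq_zero (y i)
  induction n, hn using Nat.le_induction with
  | base =>
    intro N h
    refine (subsingleton_ext_one_iff (B := ModuleCat.of R (∀ i, injHull (N i)))
      (C := ModuleCat.of R (∀ i, injHull (N i) ⧸ LinearMap.range (toInjHull (N i))))
      (hinj N) (hex N) (hsurj N) M).2 fun φ => ?_
    choose k hk using fun i => (subsingleton_ext_one_iff
      (C := ModuleCat.of R (injHull (N i) ⧸ LinearMap.range (toInjHull (N i))))
      (isInjectiveHull_toInjHull (N i)).injective
      (exact_toInjHull_mkQ (N i)) (Submodule.mkQ_surjective _) M).1 (h i) (LinearMap.proj i ∘ₗ φ)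
    exact ⟨LinearMap.pi k, LinearMap.ext fun x => funext fun i => LinearMap.congr_fun (hk i) x⟩
  | succ n hn ih =>
    intro N h
    refine (subsingleton_ext_succ_iff (B := ModuleCat.of R (∀ i, injHull (N i)))
      (C := ModuleCat.of R (∀ i, injHull (N i) ⧸ LinearMap.range (toInjHull (N i))))
      (hinj N) (hex N) (hsurj N) M hn).2
      (ih (fun i => ModuleCat.of R (injHull (N i) ⧸ LinearMap.range (toInjHull (N i))))
        fun i => ?_)
    exact (subsingleton_ext_succ_iff
      (C := ModuleCat.of R (injHull (N i) ⧸ LinearMap.range (toInjHull (N i))))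
      (isInjectiveHull_toInjHull (N i)).injective
      (exact_toInjHull_mkQ (N i)) (Submodule.mkQ_surjective _) M hn).1 (h i)

end Ext

end Cotilting

namespace Cotilting

open DirectSum

/-! ### Matlis' decomposition of injectives and the classes 𝓘(Y). -/

section Matlis

variable {R : Type u} [CommRing R]

theorem IsEssential.exists_smul {M : Type u} [AddCommGroup M] [Module R M] {N : Submodule R M}
    (h : IsEssential N) {x : M} (hx : x ≠ 0) : ∃ r : R, r • x ∈ N ∧ r • x ≠ 0 := by
  by_contra! hc
  refine hx ((Submodule.span_singleton_eq_bot (R := R)).1 (h _ ((Submodule.eq_bot_iff _).2 ?_)))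
  rintro y ⟨hyN, hy⟩
  obtain ⟨r, rfl⟩ := Submodule.mem_span_singleton.1 hy
  exact hc r hyN

theorem IsInjectiveHull.injective_of_comp {M E T : Type u} [AddCommGroup M] [Module R M]
    [AddCommGroup E] [Module R E] [AddCommGroup T] [Module R T] {f : M →ₗ[R] E}
    (hf : IsInjectiveHull f) {h : E →ₗ[R] T} (hh : Function.Injective (h ∘ₗ f)) :
    Function.Injective h := by
  rw [← LinearMap.ker_eq_bot]
  refine hf.essential _ ((Submodule.eq_bot_iff _).2 ?_)
  rintro _ ⟨⟨m, rfl⟩, hm⟩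
  have : m = 0 := hh (by simpa using hm)
  rw [this, map_zero]

/-- A non-zero multiple of `y` lies in R/𝔮, is still killed by `r`, and R/𝔮 is a domain. -/
theorem mem_of_smul_eq_zero (q : PrimeSpectrum R) {y : primeHull q} (hy : y ≠ 0) {r : R}
    (hr : r • y = 0) : r ∈ q.asIdeal := by
  have hq := isInjectiveHull_toInjHull (ModuleCat.of R (R ⧸ q.asIdeal))
  obtain ⟨s, ⟨z, hz⟩, hs0⟩ := hq.essential.exists_smul hy
  change R ⧸ q.asIdeal at z
  have hrz : r • z = 0 := hq.injective (by
    rw [map_zero, map_smul]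
    erw [hz]
    rw [smul_comm, hr, smul_zero])
  have hz0 : z ≠ 0 := fun h => hs0 (by rw [← hz, h, map_zero])
  rw [Algebra.smul_def] at hrz
  exact Ideal.Quotient.eq_zero_iff_mem.1 ((mul_eq_zero.1 hrz).resolve_right hz0)

theorem nontrivial_primeHull (p : PrimeSpectrum R) : Nontrivial (primeHull p) :=
  have : Nontrivial (R ⧸ p.asIdeal) := Ideal.Quotient.nontrivial_iff.2 p.isPrime.ne_top
  (isInjectiveHull_toInjHull (ModuleCat.of R (R ⧸ p.asIdeal))).injective.nontrivial

/-- Each copy of E(R/𝔭) is a summand of its own copy of the whole sum over `Y`, so one copy is taken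
for each pair (𝔭, element of `I 𝔭`). -/
theorem mem_injClass_of_linearEquiv {E : ModuleCat.{u} R} {Y : Set (PrimeSpectrum R)}
    {I : Y → Type u} (e : E ≃ₗ[R] ⨁ p : Y, ⨁ _ : I p, primeHull p.1) : E ∈ injClass Y := by
  classical
  let e' := e.trans (DirectSum.sigmaLcurryEquiv R (α := I) (δ := fun p _ => primeHull p.1)).symm
  refine ⟨Σ p : Y, I p,
    DirectSum.lmap (fun k => DirectSum.lof R Y (fun p => primeHull p.1) k.1) ∘ₗ e'.toLinearMap,
    e'.symm.toLinearMap ∘ₗ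
      DirectSum.lmap (fun k => DirectSum.component R Y (fun p => primeHull p.1) k.1), ?_⟩
  have h : DirectSum.lmap (fun k : Σ p : Y, I p =>
        DirectSum.component R Y (fun p => primeHull p.1) k.1) ∘ₗ
      DirectSum.lmap (fun k => DirectSum.lof R Y (fun p => primeHull p.1) k.1) =
        LinearMap.id := by
    refine DirectSum.linearMap_ext R fun k => LinearMap.ext fun x => ?_
    simp [DirectSum.component.lof_self]
  ext x
  have := LinearMap.congr_fun h (e' x)
  simp only [LinearMap.comp_apply, LinearMap.id_apply] at this
  simp only [LinearMap.comp_apply, LinearMap.id_apply, LinearEquiv.coe_coe]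
  erw [this]
  exact e'.symm_apply_apply x

variable [IsNoetherianRing R]

/-- If `x` has annihilator 𝔭 and `s • x ≠ 0` lies in `M`, then `s ∉ 𝔭`, so by primality `s • x` has
annihilator 𝔭 too. -/
theorem associatedPrimes_injHull_subset (M : ModuleCat.{u} R) :
    associatedPrimes R (injHull M) ⊆ associatedPrimes R M := by
  intro p hp
  rw [AssociatedPrimes.mem_iff, isAssociatedPrime_iff] at hp ⊢
  obtain ⟨hp, x, hx⟩ := hp
  have hmem (r : R) : r ∈ p ↔ r • x = 0 := by
    rw [hx, Submodule.mem_colon_singleton, Submodule.mem_bot]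
  have hx0 : x ≠ 0 := fun h => hp.ne_top ((Ideal.eq_top_iff_one _).2 ((hmem 1).2 (by rw [h, smul_zero])))
  have hM := isInjectiveHull_toInjHull M
  obtain ⟨s, ⟨m, hm⟩, hs0⟩ := hM.essential.exists_smul hx0
  refine ⟨hp, m, Ideal.ext fun r => ?_⟩
  have h1 : r • m = 0 ↔ r * s ∈ p := by
    rw [hmem, mul_smul, ← hm, ← map_smul, map_eq_zero_iff _ hM.injective]
  have h2 : s ∉ p := fun h => hs0 ((hmem s).1 h)
  rw [Submodule.mem_colon_singleton, Submodule.mem_bot, h1]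
  exact ⟨fun h => p.mul_mem_right s h, fun h => (hp.mem_or_mem h).resolve_right h2⟩

theorem exists_injective_primeHull {T : Type u} [AddCommGroup T] [Module R T]
    [Module.Injective R T] {p : PrimeSpectrum R} (hp : p.asIdeal ∈ associatedPrimes R T) :
    ∃ h : primeHull p →ₗ[R] T, Function.Injective h := by
  obtain ⟨-, f, hf⟩ := (isAssociatedPrime_iff_exists_injective_linearMap _ _).1 hp
  have hE := isInjectiveHull_toInjHull (ModuleCat.of R (R ⧸ p.asIdeal))
  obtain ⟨h, hh⟩ := Module.Injective.extension_property R T (R ⧸ p.asIdeal) (primeHull p)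
    (toInjHull (ModuleCat.of R (R ⧸ p.asIdeal))) hE.injective f
  exact ⟨h, hE.injective_of_comp (by rw [hh]; exact hf)⟩

theorem sSupIndep_insert {α : Type*} [CompleteLattice α] [IsModularLattice α] {s : Set α} {d : α}
    (hs : sSupIndep s) (hd : Disjoint d (sSup s)) : sSupIndep (insert d s) := by
  rintro a (rfl | ha)
  · refine hd.mono_right (sSup_le_sSup ?_)
    rintro b ⟨rfl | hb, hba⟩
    exacts [(hba rfl).elim, hb]
  · have h1 : sSup (insert d s \ {a}) ≤ sSup (s \ {a}) ⊔ d := by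
      refine sSup_le ?_
      rintro b ⟨rfl | hb, hba⟩
      exacts [le_sup_right, le_sup_of_le_left (le_sSup ⟨hb, hba⟩)]
    refine Disjoint.mono_right h1 (Disjoint.disjoint_sup_right_of_disjoint_sup_left (hs ha) ?_)
    exact (hd.mono_right (sup_le (le_sSup ha) (sSup_le_sSup Set.sdiff_subset))).symm

/-- An injective module is an internal direct sum of indecomposable injective submodules. -/
theorem exists_sSupIndep_primeHull (E : Type u) [AddCommGroup E] [Module R E]
    [Module.Injective R E] (Y : Set (PrimeSpectrum R))
    (hY : ∀ p : PrimeSpectrum R, p.asIdeal ∈ associatedPrimes R E → p ∈ Y) :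
    ∃ A : Set (Submodule R E), sSupIndep A ∧ sSup A = ⊤ ∧
      ∀ D ∈ A, ∃ p : Y, Nonempty (D ≃ₗ[R] primeHull p.1) := by
  classical
  obtain ⟨A, hA⟩ := zorn_subset
    {A : Set (Submodule R E) | sSupIndep A ∧ ∀ D ∈ A, ∃ p : Y, Nonempty (D ≃ₗ[R] primeHull p.1)}
    (by
      intro c hc hchain
      refine ⟨⋃₀ c, ⟨iSupIndep_sUnion_of_directed hchain.directedOn fun s hs => (hc hs).1, ?_⟩,
        fun s hs => Set.subset_sUnion_of_mem hs⟩
      rintro D ⟨s, hs, hD⟩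
      exact (hc hs).2 D hD)
  obtain ⟨hind, hAp⟩ := hA.prop
  refine ⟨A, hind, ?_, hAp⟩
  set S : Submodule R E := sSup A with hS
  -- A direct sum of injectives over a noetherian ring is injective, so `S` has a complement `T`.
  have hSinj : Module.Injective R S := by
    have (a : A) : Module.Injective R a.1 := by
      obtain ⟨p, ⟨e⟩⟩ := hAp a.1 a.2
      exact injective_of_retract e.toLinearMap e.symm.toLinearMap (by ext x; simp)
    have : Module.Injective R (⨁ a : A, a.1) := injective_directSum fun a : A => a.1
    let e := LinearEquiv.ofInjective (DirectSum.coeLinearMap fun a : A => a.1)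
      ((sSupIndep_iff A).1 hind).dfinsupp_lsum_injective
    have hr : LinearMap.range (DirectSum.coeLinearMap fun a : A => a.1) = S := by
      rw [DirectSum.range_coeLinearMap, hS, sSup_eq_iSup']
    rw [← hr]
    exact injective_of_retract e.symm.toLinearMap e.toLinearMap (by ext x; simp)
  obtain ⟨ρ, hρ⟩ := Module.Injective.extension_property R S S E S.subtype S.injective_subtype
    LinearMap.id
  have hρ' (x : S) : ρ x = x := LinearMap.congr_fun hρ x
  let T : Submodule R E := LinearMap.ker ρ
  let π : E →ₗ[R] T := LinearMap.codRestrict T (LinearMap.id - S.subtype ∘ₗ ρ) fun x => by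
    simp [T, hρ']
  have hπ (t : T) : π t = t := Subtype.ext (by
    have h : ρ t = 0 := t.2
    change (t : E) - (ρ t : E) = t
    rw [h, ZeroMemClass.coe_zero, sub_zero])
  have hTinj : Module.Injective R T := injective_of_retract T.subtype π (LinearMap.ext hπ)
  have hST : Disjoint T S := Submodule.disjoint_def.2 fun x hxT hxS => by
    have h1 := hρ' ⟨x, hxS⟩
    have h2 : ρ x = 0 := hxT
    rw [h2] at h1
    exact (congrArg Subtype.val h1).symm
  -- A non-zero `T` contains a copy `D` of some E(R/𝔭). By maximality `D` already belongs to `A`, so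
  -- `D ≤ S`, although `D` is disjoint from `S`.
  have hT : Subsingleton T := by
    by_contra hne
    rw [not_subsingleton_iff_nontrivial] at hne
    obtain ⟨p, hp⟩ := associatedPrimes.nonempty R T
    obtain ⟨j, hj⟩ := exists_injective_primeHull (p := ⟨p, hp.isPrime⟩) hp
    let D : Submodule R E := LinearMap.range (T.subtype ∘ₗ j)
    have eD : primeHull ⟨p, hp.isPrime⟩ ≃ₗ[R] D :=
      LinearEquiv.ofInjective (T.subtype ∘ₗ j) (T.injective_subtype.comp hj)
    have hDT : D ≤ T := by
      rintro _ ⟨x, rfl⟩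
      exact (j x).2
    have hDA : D ∈ A := hA.le_of_ge ⟨sSupIndep_insert hind (hST.mono_left hDT), by
      rintro B (rfl | hB)
      · exact ⟨⟨⟨p, hp.isPrime⟩, hY _ (associatedPrimes.subset_of_injective
          T.injective_subtype hp)⟩, ⟨eD.symm⟩⟩
      · exact hAp B hB⟩ (Set.subset_insert D A) (Set.mem_insert D A)
    have hD0 : D = ⊥ := (hST.mono_left hDT).eq_bot_of_le (le_sSup hDA)
    have := nontrivial_primeHull (⟨p, hp.isPrime⟩ : PrimeSpectrum R)
    have : Nontrivial D := eD.symm.toEquiv.nontrivial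
    exact (Submodule.nontrivial_iff_ne_bot.1 this) hD0
  refine eq_top_iff.2 fun x _ => ?_
  have h1 : ((π x : T) : E) = 0 := congrArg Subtype.val (hT.elim (π x) 0)
  have h2 : x - (ρ x : E) = 0 := h1
  rw [sub_eq_zero.1 h2]
  exact (ρ x).2

/-- An injective module whose associated primes lie in `Y` is a direct sum of copies of the modules
`E(R/𝔭)` with `𝔭 ∈ Y`. -/
theorem exists_linearEquiv_directSum_primeHull (E : Type u) [AddCommGroup E] [Module R E]
    [Module.Injective R E] (Y : Set (PrimeSpectrum R))
    (hY : ∀ p : PrimeSpectrum R, p.asIdeal ∈ associatedPrimes R E → p ∈ Y) :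
    ∃ I : Y → Type u, Nonempty (E ≃ₗ[R] ⨁ p : Y, ⨁ _ : I p, primeHull p.1) := by
  classical
  obtain ⟨A, hind, htop, hA⟩ := exists_sSupIndep_primeHull E Y hY
  choose π e using fun a : A => hA a.1 a.2
  have hint : DirectSum.IsInternal fun a : A => a.1 :=
    DirectSum.isInternal_submodule_of_iSupIndep_of_iSup_eq_top ((sSupIndep_iff A).1 hind)
      (by rw [← sSup_eq_iSup', htop])
  have e1 : (⨁ a : A, a.1) ≃ₗ[R] E := LinearEquiv.ofBijective (DirectSum.coeLinearMap _) hint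
  have e2 : (⨁ a : A, a.1) ≃ₗ[R] ⨁ a : A, primeHull (π a).1 :=
    DirectSum.congrLinearEquiv fun a => (e a).some
  -- The summands are grouped by their prime, that is, by the fibres of `π`.
  have e3 := DirectSum.lequivCongrLeft R (M := fun a : A => primeHull (π a).1)
    (Equiv.sigmaFiberEquiv π).symm
  have e4 : (⨁ k : Σ p : Y, {a // π a = p}, primeHull (π ((Equiv.sigmaFiberEquiv π) k)).1) ≃ₗ[R]
      ⨁ k : Σ p : Y, {a // π a = p}, primeHull k.1.1 :=
    DirectSum.congrLinearEquiv fun k => by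
      obtain ⟨p, a, rfl⟩ := k
      exact LinearEquiv.refl R _
  have e5 := DirectSum.sigmaLcurryEquiv R (α := fun p : Y => {a // π a = p})
    (δ := fun p _ => primeHull p.1)
  exact ⟨fun p => {a // π a = p}, ⟨e1.symm.trans (e2.trans (e3.trans (e4.trans e5)))⟩⟩

theorem injective_of_mem_injClass {E : ModuleCat.{u} R} {Y : Set (PrimeSpectrum R)}
    (h : E ∈ injClass Y) : Module.Injective R E := by
  obtain ⟨I, i, r, hir⟩ := h
  have : Module.Injective R (sumPrimeHulls Y) := injective_directSum fun p : Y => primeHull p.1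
  have : Module.Injective R (⨁ _ : I, sumPrimeHulls Y) := injective_directSum fun _ => _
  exact injective_of_retract i r hir

/-- An element with annihilator 𝔭 has a non-zero coordinate in some E(R/𝔮) with 𝔮 ∈ Y, whence 𝔭 ⊆ 𝔮
and generalization closedness applies. The converse is Matlis' decomposition. -/
theorem mem_injClass_iff {E : ModuleCat.{u} R} {Y : Set (PrimeSpectrum R)}
    (hY : GeneralizationClosed Y) :
    E ∈ injClass Y ↔ Module.Injective R E ∧
      ∀ p : PrimeSpectrum R, p.asIdeal ∈ associatedPrimes R E → p ∈ Y := by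
  refine ⟨fun h => ⟨injective_of_mem_injClass h, fun p hp => ?_⟩, fun ⟨_, h⟩ => ?_⟩
  · obtain ⟨I, i, r, hir⟩ := h
    obtain ⟨-, x, hx⟩ := isAssociatedPrime_iff.1 hp
    have hmem (s : R) : s ∈ p.asIdeal ↔ s • x = 0 := by
      rw [hx, Submodule.mem_colon_singleton, Submodule.mem_bot]
    have hx0 : x ≠ 0 := fun h => p.isPrime.ne_top
      ((Ideal.eq_top_iff_one _).2 ((hmem 1).2 (by rw [h, smul_zero])))
    have hix : i x ≠ 0 := fun h => hx0 (by
      have := LinearMap.congr_fun hir x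
      rw [LinearMap.comp_apply, h, map_zero] at this
      exact this.symm)
    obtain ⟨a, ha⟩ := DFunLike.ne_iff.1 hix
    let y : ⨁ q : Y, primeHull q.1 := i x a
    have hy : y ≠ 0 := ha
    obtain ⟨q, hq⟩ := DFunLike.ne_iff.1 hy
    refine hY q.1 q.2 p fun s hs => mem_of_smul_eq_zero q.1 hq ?_
    have h0 : s • i x = 0 := by rw [← map_smul, (hmem s).1 hs, map_zero]
    have h1 : s • y = 0 := DFunLike.congr_fun h0 a
    exact DFunLike.congr_fun h1 q
  · obtain ⟨I, ⟨e⟩⟩ := exists_linearEquiv_directSum_primeHull E Y h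
    exact mem_injClass_of_linearEquiv e

theorem injHull_mem_injClass {M : ModuleCat.{u} R} {Y : Set (PrimeSpectrum R)}
    (hM : ∀ p : PrimeSpectrum R, p.asIdeal ∈ associatedPrimes R M → p ∈ Y) :
    injHull M ∈ injClass Y := by
  obtain ⟨I, ⟨e⟩⟩ := exists_linearEquiv_directSum_primeHull (injHull M) Y
    fun p hp => hM p (associatedPrimes_injHull_subset M hp)
  exact mem_injClass_of_linearEquiv e

theorem injHull_mem_injClass_iff {M : ModuleCat.{u} R} {Y : Set (PrimeSpectrum R)}
    (hY : GeneralizationClosed Y) :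
    injHull M ∈ injClass Y ↔ ∃ I : Y → Type u,
      Nonempty (injHull M ≃ₗ[R] ⨁ p : Y, ⨁ _ : I p, primeHull p.1) :=
  ⟨fun h => exists_linearEquiv_directSum_primeHull _ Y ((mem_injClass_iff hY).1 h).2,
    fun ⟨_, ⟨e⟩⟩ => mem_injClass_of_linearEquiv e⟩

theorem injClass_mono {Y Y' : Set (PrimeSpectrum R)} (hY : GeneralizationClosed Y)
    (hY' : GeneralizationClosed Y') (h : Y ⊆ Y') : injClass Y ⊆ injClass Y' := fun _ hE =>
  have hE := (mem_injClass_iff hY).1 hE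
  (mem_injClass_iff hY').2 ⟨hE.1, fun p hp => h (hE.2 p hp)⟩

end Matlis

end Cotilting

namespace Cotilting

open CategoryTheory Abelian

/-! ### Iterated cosyzygies and cosyzygies of injectives. -/

section Cosyzygy

variable {R : Type u} [CommRing R]

theorem cosyzygy_cosyzygy_one (X : ModuleCat.{u} R) (t : ℕ) :
    cosyzygy (cosyzygy X 1) t = cosyzygy X (t + 1) := by
  induction t with
  | zero => rfl
  | succ t ih =>
    exact congrArg (fun A : ModuleCat.{u} R =>
      ModuleCat.of R (injHull A ⧸ LinearMap.range (toInjHull A))) ih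

theorem toInjHull_surjective (M : ModuleCat.{u} R) [Module.Injective R M] :
    Function.Surjective (toInjHull M) := by
  have hM := isInjectiveHull_toInjHull M
  obtain ⟨ρ, hρ⟩ := Module.Injective.extension_property R M M (injHull M) (toInjHull M)
    hM.injective LinearMap.id
  have hinj : Function.Injective ρ := hM.injective_of_comp (by rw [hρ]; exact fun _ _ h => h)
  exact fun x => ⟨ρ x, hinj (LinearMap.congr_fun hρ (ρ x))⟩

theorem subsingleton_cosyzygy_succ (M : ModuleCat.{u} R) (i : ℕ)
    (h : Module.Injective R (cosyzygy M i)) : Subsingleton (cosyzygy M (i + 1)) :=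
  Submodule.Quotient.subsingleton_iff.2
    (LinearMap.range_eq_top.2 (toInjHull_surjective (cosyzygy M i)))

theorem injective_of_subsingleton (M : Type u) [AddCommGroup M] [Module R M] [Subsingleton M] :
    Module.Injective R M :=
  ⟨fun _ _ _ _ _ _ _ _ _ => ⟨0, fun _ => Subsingleton.elim _ _⟩⟩

theorem injective_cosyzygy (M : ModuleCat.{u} R) [h : Module.Injective R M] (i : ℕ) :
    Module.Injective R (cosyzygy M i) := by
  induction i with
  | zero => exact h
  | succ i ih =>
    have := subsingleton_cosyzygy_succ M i ih
    exact injective_of_subsingleton _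

end Cosyzygy

/-! ### Shifted classes and lifting through covers. -/

namespace SpecSequence

variable {R : Type u} [CommRing R] (𝒴 : SpecSequence R)

/-- The class of all modules `X` with `E(℧ᵗ X) ∈ 𝓘(Y (s + t))` for all `t`. -/
def shiftedClass (s : ℕ) : Set (ModuleCat.{u} R) :=
  {X | ∀ t, injHull (cosyzygy X t) ∈ injClass (𝒴.Y (s + t))}

variable {𝒴}

theorem cosyzygy_one_mem_shiftedClass {s : ℕ} {X : ModuleCat.{u} R} (hX : X ∈ 𝒴.shiftedClass s) :
    cosyzygy X 1 ∈ 𝒴.shiftedClass (s + 1) := fun t => by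
  rw [cosyzygy_cosyzygy_one, show s + 1 + t = s + (t + 1) by lia]
  exact hX (t + 1)

variable [IsNoetherianRing R]

theorem shiftedClass_mono {s s' : ℕ} (h : s ≤ s') : 𝒴.shiftedClass s ⊆ 𝒴.shiftedClass s' :=
  fun _ hX t => injClass_mono (𝒴.generalizationClosed _) (𝒴.generalizationClosed _)
    (𝒴.monotone (by lia)) (hX t)

theorem mem_cotiltingClass_iff {X : ModuleCat.{u} R} :
    X ∈ 𝒴.cotiltingClass ↔ ∀ i, injHull (cosyzygy X i) ∈ injClass (𝒴.Y i) :=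
  forall_congr' fun i => (injHull_mem_injClass_iff (𝒴.generalizationClosed i)).symm

theorem ring_mem_shiftedClass (s : ℕ) : ModuleCat.of R R ∈ 𝒴.shiftedClass s :=
  shiftedClass_mono s.zero_le fun t => injHull_mem_injClass (by
    rw [zero_add]
    exact 𝒴.ass_subset t)

/-- The positive cosyzygies of an injective module vanish, so they have no associated primes. -/
theorem mem_shiftedClass_of_mem_injClass {s : ℕ} {E : ModuleCat.{u} R}
    (hE : E ∈ injClass (𝒴.Y s)) : E ∈ 𝒴.shiftedClass s := by
  have hE' := (mem_injClass_iff (𝒴.generalizationClosed s)).1 hE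
  have := hE'.1
  rintro (_ | t) <;> refine injHull_mem_injClass ?_
  · exact hE'.2
  · have := subsingleton_cosyzygy_succ E t (injective_cosyzygy E t)
    rw [associatedPrimes.eq_empty_of_subsingleton]
    exact fun _ h => h.elim

variable (𝒴) in
/-- Every homomorphism from a module in `𝒴.shiftedClass j` to `N` factors through the
`𝓘(Y j)`-cover of `N`. -/
def LiftsToCover (j : ℕ) (N : ModuleCat.{u} R) : Prop :=
  ∀ X ∈ 𝒴.shiftedClass j, ∀ φ : X →ₗ[R] N,
    ∃ ψ : X →ₗ[R] coverObj (𝒴.Y j) N, coverMap (𝒴.Y j) N ∘ₗ ψ = φ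

instance injective_coverObj (Y : Set (PrimeSpectrum R)) (N : ModuleCat.{u} R) :
    Module.Injective R (coverObj Y N) :=
  injective_of_mem_injClass (isCover_coverMap Y N).mem

/-- The map extends to E(X), which lies in 𝓘(Y j), and there the precover property applies. -/
theorem liftsToCover_of_injective (j : ℕ) (N : ModuleCat.{u} R) [Module.Injective R N] :
    𝒴.LiftsToCover j N := by
  intro X hX φ
  obtain ⟨Φ, hΦ⟩ := Module.Injective.extension_property R N X (injHull X) (toInjHull X)
    (isInjectiveHull_toInjHull X).injective φ
  obtain ⟨ψ, hψ⟩ := (isCover_coverMap (𝒴.Y j) N).lift (injHull X) (hX 0) Φ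
  exact ⟨ψ ∘ₗ toInjHull X, by rw [← LinearMap.comp_assoc, hψ, hΦ]⟩

/-- The inductive heart: a map from `X` into the kernel is extended to E(X), the obstruction living
on ℧X, which is in the next shifted class and so is handled by the hypothesis on `N`. -/
theorem LiftsToCover.ker {j : ℕ} {N : ModuleCat.{u} R} (h : 𝒴.LiftsToCover (j + 1) N) :
    𝒴.LiftsToCover j (ModuleCat.of R (LinearMap.ker (coverMap (𝒴.Y (j + 1)) N))) := by
  set c := coverMap (𝒴.Y (j + 1)) N
  intro X hX (φ : X →ₗ[R] LinearMap.ker c)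
  obtain ⟨Φ, hΦ⟩ := Module.Injective.extension_property R (coverObj (𝒴.Y (j + 1)) N) X (injHull X)
    (toInjHull X) (isInjectiveHull_toInjHull X).injective ((LinearMap.ker c).subtype ∘ₗ φ)
  have hΦ' (x : X) : Φ (toInjHull X x) = φ x := LinearMap.congr_fun hΦ x
  -- `c ∘ Φ` vanishes on `X`, so it induces a map ℧X → N, which lifts to `ψ`.
  obtain ⟨ψ, hψ⟩ := h _ (cosyzygy_one_mem_shiftedClass hX)
    ((LinearMap.range (toInjHull X)).liftQ (c ∘ₗ Φ) (by
      rintro _ ⟨x, rfl⟩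
      rw [LinearMap.mem_ker, LinearMap.comp_apply, hΦ']
      exact (φ x).2))
  change (injHull X ⧸ LinearMap.range (toInjHull X)) →ₗ[R] _ at ψ
  have hψ' (e : injHull X) : c (ψ ((LinearMap.range (toInjHull X)).mkQ e)) = c (Φ e) :=
    LinearMap.congr_fun hψ ((LinearMap.range (toInjHull X)).mkQ e)
  -- Subtracting `ψ` forces the values into `ker c` without changing them on `X`, where `ψ`
  -- contributes nothing.
  let Θ : injHull X →ₗ[R] LinearMap.ker c := LinearMap.codRestrict _
    (Φ - ψ ∘ₗ (LinearMap.range (toInjHull X)).mkQ) fun e => by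
      rw [LinearMap.mem_ker, LinearMap.sub_apply, map_sub, LinearMap.comp_apply, hψ', sub_self]
  obtain ⟨g, hg⟩ := (isCover_coverMap (𝒴.Y j) (ModuleCat.of R (LinearMap.ker c))).lift (injHull X)
    (hX 0) Θ
  refine ⟨g ∘ₗ toInjHull X, LinearMap.ext fun x =>
    (LinearMap.congr_fun hg (toInjHull X x)).trans (Subtype.ext ?_)⟩
  change Φ (toInjHull X x) - ψ ((LinearMap.range (toInjHull X)).mkQ (toInjHull X x)) = φ x
  rw [(exact_toInjHull_mkQ X).apply_apply_eq_zero, map_zero, sub_zero, hΦ']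

/-- Each element of `N` is the image of 1 under a map from R, and R lies in every shifted class. -/
theorem LiftsToCover.surjective {j : ℕ} {N : ModuleCat.{u} R} (h : 𝒴.LiftsToCover j N) :
    Function.Surjective (coverMap (𝒴.Y j) N) := fun x => by
  obtain ⟨ψ, hψ⟩ := h _ (ring_mem_shiftedClass j) (LinearMap.toSpanSingleton R N x)
  refine ⟨ψ (1 : R), ?_⟩
  have := LinearMap.congr_fun hψ (1 : R)
  rwa [LinearMap.toSpanSingleton_apply, one_smul] at this

theorem LiftsToCover.subsingleton_ext_ker_succ_iff {j : ℕ} {N : ModuleCat.{u} R}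
    (h : 𝒴.LiftsToCover j N) (M : ModuleCat.{u} R) {n : ℕ} (hn : 1 ≤ n) :
    Subsingleton (Ext M (ModuleCat.of R (LinearMap.ker (coverMap (𝒴.Y j) N))) (n + 1)) ↔
      Subsingleton (Ext M N n) :=
  subsingleton_ext_succ_iff (f := (LinearMap.ker (coverMap (𝒴.Y j) N)).subtype)
    (Submodule.injective_subtype _) (LinearMap.exact_subtype_ker_map _) h.surjective M hn

theorem LiftsToCover.subsingleton_ext_ker_one_iff {j : ℕ} {N : ModuleCat.{u} R}
    (h : 𝒴.LiftsToCover j N) (M : ModuleCat.{u} R) :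
    Subsingleton (Ext M (ModuleCat.of R (LinearMap.ker (coverMap (𝒴.Y j) N))) 1) ↔
      ∀ φ : M →ₗ[R] N, ∃ ψ : M →ₗ[R] coverObj (𝒴.Y j) N, coverMap (𝒴.Y j) N ∘ₗ ψ = φ :=
  subsingleton_ext_one_iff (f := (LinearMap.ker (coverMap (𝒴.Y j) N)).subtype)
    (Submodule.injective_subtype _) (LinearMap.exact_subtype_ker_map _) h.surjective M

/-! ### Dimension shifting along the iterated kernels. -/

/-- `N` plays the role of K_j, to be covered next by 𝓘(Y (j - 1)); the lifting hypothesis is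
therefore void for `j = 0`. The bound on `k + j` is preserved, since going down one kernel raises
`k` by one. -/
theorem subsingleton_ext_iteratedKernel {s : ℕ} {X : ModuleCat.{u} R}
    (hX : X ∈ 𝒴.shiftedClass s) (j : ℕ) : ∀ N : ModuleCat.{u} R,
    (∀ l, j = l + 1 → 𝒴.LiftsToCover l N) →
    (∀ k, 1 ≤ k → s + 1 ≤ k + j → Subsingleton (Ext X N k)) →
    ∀ k, s + 1 ≤ k → Subsingleton (Ext X (iteratedKernel 𝒴.Y j N) k) := by
  induction j with
  | zero => exact fun N _ hN k hk => hN k (by lia) (by lia)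
  | succ j ih =>
    intro N hl hN
    have hj := hl j rfl
    refine ih _ (fun l hjl => ?_) fun k hk hsk => ?_
    · subst hjl
      exact hj.ker
    · obtain ⟨k, rfl⟩ := Nat.exists_eq_add_of_le' hk
      rcases k.eq_zero_or_pos with rfl | hk0
      -- In degree one the bound reads `s ≤ j`, so `X` belongs to the `j`-th shifted class.
      · exact (hj.subsingleton_ext_ker_one_iff X).2 (hj X (shiftedClass_mono (by lia) hX))
      · exact (hj.subsingleton_ext_ker_succ_iff X hk0).2 (hN k hk0 (by lia))

/-- Climbing back up starts from a degree `k ≥ 1` at `N`, so only the isomorphisms in positive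
degrees occur and `M` may be arbitrary. -/
theorem subsingleton_ext_of_iteratedKernel {M : ModuleCat.{u} R} (j : ℕ) :
    ∀ (N : ModuleCat.{u} R) (k : ℕ), 1 ≤ k → (∀ l, j = l + 1 → 𝒴.LiftsToCover l N) →
      Subsingleton (Ext M (iteratedKernel 𝒴.Y j N) (k + j)) → Subsingleton (Ext M N k) := by
  induction j with
  | zero => exact fun _ _ _ _ h => h
  | succ j ih =>
    intro N k hk hl h
    have hj := hl j rfl
    refine (hj.subsingleton_ext_ker_succ_iff M hk).1 (ih _ (k + 1) (by lia) (fun l hjl => ?_) ?_)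
    · subst hjl
      exact hj.ker
    · rwa [show k + 1 + j = k + (j + 1) by lia]

theorem subsingleton_ext_primeModule {s k : ℕ} {X : ModuleCat.{u} R}
    (hX : X ∈ 𝒴.shiftedClass s) (hk : s + 1 ≤ k) (p : PrimeSpectrum R) :
    Subsingleton (Ext X (𝒴.primeModule p) k) :=
  subsingleton_ext_iteratedKernel hX _ _ (fun l _ => liftsToCover_of_injective l _)
    (fun _ hk _ => subsingleton_ext_of_injective X _ hk) k hk

theorem cotiltingClass_subset_leftPerp : 𝒴.cotiltingClass ⊆ leftPerp 𝒴.cotiltingModule := by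
  intro X hX i hi
  have hX' : X ∈ 𝒴.shiftedClass 0 := fun t => by
    rw [zero_add]
    exact mem_cotiltingClass_iff.1 hX t
  exact subsingleton_ext_pi X hi _ (subsingleton_ext_primeModule hX' (by lia))

/-! ### From Ext-vanishing to associated primes. -/

theorem mem_of_subsingleton_ext {i : ℕ} {M : ModuleCat.{u} R} {p : PrimeSpectrum R}
    (hM : ∀ k, i + 1 ≤ k → Subsingleton (Ext M (𝒴.primeModule p) k))
    (hp : p.asIdeal ∈ associatedPrimes R M) : p ∈ 𝒴.Y i := by
  classical
  by_contra hpi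
  have hlevel : i < 𝒴.level p := by
    by_contra! h
    exact hpi (𝒴.monotone h (Nat.find_spec (𝒴.exists_mem p)))
  obtain ⟨l, hl⟩ : ∃ l, 𝒴.level p = l + 1 := Nat.exists_eq_succ_of_ne_zero (by lia)
  have hpl : p ∉ 𝒴.Y l := Nat.find_min (𝒴.exists_mem p) (show l < 𝒴.level p by lia)
  have hlift : 𝒴.LiftsToCover l (primeHull p) := liftsToCover_of_injective l _
  -- Degree `1 + l` at C_𝔭 becomes degree one at the kernel of the 𝓘(Y l)-cover of E(R/𝔭), so every
  -- map `M` → E(R/𝔭) lifts to that cover.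
  have hext := hM (1 + l) (by lia)
  rw [primeModule, hl, iteratedKernel] at hext
  replace hext := subsingleton_ext_of_iteratedKernel l _ 1 le_rfl
    (fun m hm => by subst hm; exact hlift.ker) hext
  obtain ⟨-, f, hf⟩ := (isAssociatedPrime_iff_exists_injective_linearMap _ _).1 hp
  let ι := toInjHull (ModuleCat.of R (R ⧸ p.asIdeal))
  have hι : Function.Injective ι := (isInjectiveHull_toInjHull _).injective
  obtain ⟨φ, hφ⟩ := Module.Injective.extension_property R (primeHull p) (R ⧸ p.asIdeal) M f hf ι
  obtain ⟨ψ, hψ⟩ := (hlift.subsingleton_ext_ker_one_iff M).1 hext φ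
  -- The lift embeds R/𝔭 in a module of 𝓘(Y l), which would put 𝔭 in `Y l`.
  have hinj : Function.Injective (ψ ∘ₗ f) := by
    refine Function.Injective.of_comp (f := coverMap (𝒴.Y l) (primeHull p)) ?_
    rw [← LinearMap.coe_comp, ← LinearMap.comp_assoc, hψ, hφ]
    exact hι
  exact hpl (((mem_injClass_iff (𝒴.generalizationClosed l)).1
    (isCover_coverMap (𝒴.Y l) (primeHull p)).mem).2 p
      ((isAssociatedPrime_iff_exists_injective_linearMap _ _).2 ⟨p.isPrime, _, hinj⟩))

/-- The induction carries Extᵏ(℧ⁱM, C_𝔭) = 0 for k > i and all 𝔭. This puts E(℧ⁱM) in 𝓘(Y i), hence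
in the `i`-th shifted class, so that its own Ext groups into C_𝔭 vanish in degrees above `i`, as the
next step needs. -/
theorem leftPerp_subset_cotiltingClass : leftPerp 𝒴.cotiltingModule ⊆ 𝒴.cotiltingClass := by
  classical
  intro M hM
  have hull (i : ℕ) (h : ∀ p k, i + 1 ≤ k →
      Subsingleton (Ext (cosyzygy M i) (𝒴.primeModule p) k)) :
      injHull (cosyzygy M i) ∈ injClass (𝒴.Y i) :=
    injHull_mem_injClass fun p hp => mem_of_subsingleton_ext (h p) hp
  refine mem_cotiltingClass_iff.2 fun i => hull i ?_
  induction i with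
  | zero =>
    intro p k hk
    refine subsingleton_ext_of_retract (P := 𝒴.cotiltingModule)
      (LinearMap.single R (fun p => 𝒴.primeModule p) p) (LinearMap.proj p) ?_ (hM k hk)
    exact LinearMap.proj_comp_single_same R _ p
  | succ i ih =>
    intro p k hk
    obtain ⟨k, rfl⟩ := Nat.exists_eq_add_of_le' (show 1 ≤ k by lia)
    exact subsingleton_ext_coker (isInjectiveHull_toInjHull (cosyzygy M i)).injective
      (exact_toInjHull_mkQ _) (Submodule.mkQ_surjective _) _ (ih p k (by lia))
      (subsingleton_ext_primeModule (mem_shiftedClass_of_mem_injClass (hull i ih)) (by lia) p)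

end SpecSequence

end Cotilting

theorem mainTheorem6 {R : Type u} [CommRing R] [IsNoetherianRing R]
    (𝒴 : Cotilting.SpecSequence R) :
    Cotilting.leftPerp 𝒴.cotiltingModule ⊆ 𝒴.cotiltingClass ∧
      ∀ n : ℕ, 1 ≤ n → 𝒴.Y n = Set.univ →
        Cotilting.leftPerp 𝒴.cotiltingModule = 𝒴.cotiltingClass :=
  ⟨Cotilting.SpecSequence.leftPerp_subset_cotiltingClass, fun _ _ _ =>
    Cotilting.SpecSequence.leftPerp_subset_cotiltingClass.antisymm
      Cotilting.SpecSequence.cotiltingClass_subset_leftPerp⟩
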